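/- **Corollary 1.** For $\theta\ge 0$ let $K(\theta)=\{z\in\mathbb{C}: |\arg z|\le\theta\}$, with $0\in K(\theta)$. A complex sequence $\mathbf{c}=\{c_n\}$ belongs to the class $\mathrm{GBV}$ if there is $\theta_1\in[0,\pi/2)$ with $c_n\in K(\theta_1)$ for all $n\ge 1$, and there are an integer $N_0\ge 1$ and a constant $M>0$ such that $$\sum_{n=m}^{2m}|c_n-c_{n+1}|\le M\max_{m\le n<m+N_0}|c_n|\qquad\text{for all } m=1,2,\dots$$ (no condition is imposed on $c_0$). Let $f:\mathbb{R}\to\mathbb{C}$ be $2\pi$-periodic and integrable on $[-\pi,\pi]$, let $\hat f(k)=\frac1{2\pi}\int_{-\pi}^{\pi}f(x)e^{-ikx}\,dx$ for $k\in\mathbb{Z}$, let $S_n(f,x)=\sum_{k=-n}^{n}\hat f(k)e^{ikx}$, and let $\|g\|=\int_{-\pi}^{\pi}|g(x)|\,dx$. If both $\{\hat f(n)\}_{n\ge 0}$ and $\{\hat f(-n)\}_{n\ge 0}$ belong to $\mathrm{GBV}$, then $$\lim_{n\to\infty}\|f-S_n(f)\|=0\quad\text{if and only if}\quad \lim_{|n|\to\infty}\hat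 f(n)\log|n|=0,$$ where in the second limit $n$ runs over the integers, so that both $n\to+\infty$ and $n\to-\infty$ are meant. -/

import Mathlib

open Filter Topology MeasureTheory

noncomputable section

namespace GBVFourier

/-- The closed sector `{z : |arg z| ≤ θ}`. It contains `0`, as `Complex.arg 0 = 0`. -/
def sector (θ : ℝ) : Set ℂ := {z | |Complex.arg z| ≤ θ}

/-- The class GBV. Only the terms `c n` with `n ≥ 1` matter. The maximum of `|c n|` over the
nonempty window `m ≤ n < m + N₀` is written as a finite supremum of nonnegative reals. -/
def IsGBV (c : ℕ → ℂ) : Prop :=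
  (∃ θ : ℝ, 0 ≤ θ ∧ θ < Real.pi / 2 ∧ ∀ n : ℕ, 1 ≤ n → c n ∈ sector θ) ∧
  ∃ N₀ : ℕ, 1 ≤ N₀ ∧ ∃ M : ℝ, 0 < M ∧ ∀ m : ℕ, 1 ≤ m →
    ∑ n ∈ Finset.Icc m (2 * m), ‖c n - c (n + 1)‖ ≤
      M * ((Finset.Ico m (m + N₀)).sup (fun n => ‖c n‖₊) : NNReal)

/-- The `n`-th Fourier coefficient of a `2π`-periodic function, over the period `(-π, π]`. -/
def coeff (f : ℝ → ℂ) (n : ℤ) : ℂ :=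
  fourierCoeffOn (neg_lt_self Real.pi_pos) f n

theorem coeff_eq_integral (f : ℝ → ℂ) (n : ℤ) :
    coeff f n = (1 / (2 * Real.pi) : ℝ) •
      ∫ x in (-Real.pi)..Real.pi, Complex.exp (-(Complex.I * n * x)) * f x := by
  rw [coeff, fourierCoeffOn_eq_integral]
  have hp : (Real.pi : ℂ) ≠ 0 := by exact_mod_cast Real.pi_ne_zero
  congr 1
  · congr 1; ring
  · refine intervalIntegral.integral_congr fun x _ => ?_
    simp only [fourier_coe_apply, smul_eq_mul]
    congr 2
    push_cast
    field_simp
    ring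

/-- The symmetric partial sum `∑_{k=-n}^{n} f̂(k) e^{ikx}`. -/
def partialSum (f : ℝ → ℂ) (n : ℕ) (x : ℝ) : ℂ :=
  ∑ k ∈ Finset.Icc (-(n : ℤ)) (n : ℤ), coeff f k * Complex.exp (Complex.I * k * x)

/-- The norm `∫_{-π}^{π} |g(x)| dx`. -/
def l1Norm (g : ℝ → ℂ) : ℝ := ∫ x in (-Real.pi)..Real.pi, ‖g x‖

end GBVFourier

end

/-! Necessity is a duality argument. Multiply `f - S_n` by `e^{-inx}` times the polynomial `2i ∑_{k
≤ 2n} sin(kx)/k`, which is bounded uniformly in `n` and `x`. One half of the frequencies falls in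
`[-n, n]`, where `f - S_n` has no coefficients; the other half leaves `∑ c_{n+k}/k`, with `c` the
coefficient sequence, bounded by a multiple of `‖f - S_n‖` (`norm_sum_coeff_div_le`). The sector
condition forbids cancellation, so `∑ |c_{n+k}|/k` is small too, and the variation condition, which
bounds `|c_{2n}|` by the terms in a window at each `n+k`, turns this into `|c_{2n}| log n → 0`
(`norm_mul_log_le`). Negative frequencies follow by the reflection `x ↦ -x`.

For sufficiency, compare `S_n` with the de la Vallée Poussin mean `V_n`, the average of `S_n, …,
S_{2n-1}`. For every integrable `f`, `V_n → f` in `L¹`, because the kernels are bounded in `L¹` and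
trigonometric polynomials are dense (`tendsto_l1Norm_sub_vpMean`). The difference `V_n - S_n`
averages blocks of frequencies of modulus between `n` and `2n`. Abel summation bounds a block by
`log n` times a last coefficient plus the variation, and both are `o(1/log n)`
(`IsGBV.eventually_l1Norm_block_le`). -/

noncomputable section

namespace GBVFourier

/-! ### Exponentials and the `L¹` norm. -/

/-- The exponential `x ↦ e^{ikx}`. -/
def wave (k : ℤ) (x : ℝ) : ℂ := Complex.exp (Complex.I * k * x)

theorem wave_zero (x : ℝ) : wave 0 x = 1 := by simp [wave]

theorem wave_add (k l : ℤ) (x : ℝ) : wave (k + l) x = wave k x * wave l x := by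
  rw [wave, wave, wave, ← Complex.exp_add]
  push_cast
  ring_nf

theorem wave_neg_apply (k : ℤ) (x : ℝ) : wave k (-x) = wave (-k) x := by
  simp [wave]

theorem norm_wave (k : ℤ) (x : ℝ) : ‖wave k x‖ = 1 := by
  have h : Complex.I * k * x = Complex.I * ((k * x : ℝ) : ℂ) := by push_cast; ring
  rw [wave, h, Complex.norm_exp_I_mul_ofReal]

theorem conj_wave (k : ℤ) (x : ℝ) : (starRingEnd ℂ) (wave k x) = wave (-k) x := by
  simp [wave, ← Complex.exp_conj]

theorem wave_sub_apply (k : ℤ) (x y : ℝ) : wave k (x - y) = wave k x * wave (-k) y := by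
  rw [wave, wave, wave, ← Complex.exp_add]
  push_cast
  ring_nf

@[fun_prop]
theorem continuous_wave (k : ℤ) : Continuous (wave k) := by
  unfold wave; fun_prop

theorem wave_periodic (k : ℤ) : Function.Periodic (wave k) (2 * Real.pi) := by
  intro x
  have h : Complex.I * k * ((x + 2 * Real.pi : ℝ) : ℂ)
      = Complex.I * k * x + k * (2 * Real.pi * Complex.I) := by push_cast; ring
  rw [wave, wave, h, Complex.exp_add, Complex.exp_int_mul_two_pi_mul_I, mul_one]

theorem integral_wave_of_ne {k : ℤ} (hk : k ≠ 0) :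
    ∫ x in (-Real.pi)..Real.pi, wave k x = 0 := by
  have hc : Complex.I * k ≠ 0 := by simp [hk]
  have h := integral_exp_mul_complex (a := -Real.pi) (b := Real.pi) hc
  have hp : Complex.exp (Complex.I * k * (Real.pi : ℝ))
      = Complex.exp (Complex.I * k * ((-Real.pi : ℝ) : ℂ)) := by
    have := wave_periodic k (-Real.pi)
    rw [show -Real.pi + 2 * Real.pi = Real.pi by ring] at this
    exact this
  unfold wave
  rw [h, hp, sub_self, zero_div]

theorem integral_wave_zero : ∫ x in (-Real.pi)..Real.pi, wave 0 x = 2 * Real.pi := by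
  simp only [wave_zero, intervalIntegral.integral_const]
  rw [Complex.real_smul]
  push_cast
  ring

theorem l1Norm_nonneg (g : ℝ → ℂ) : 0 ≤ l1Norm g :=
  intervalIntegral.integral_nonneg (by linarith [Real.pi_pos]) fun _ _ => norm_nonneg _

theorem neg_pi_le_pi : -Real.pi ≤ Real.pi := by linarith [Real.pi_pos]

theorem l1Norm_mono_of_norm_le {g : ℝ → ℂ} {h : ℝ → ℝ}
    (hg : IntervalIntegrable g volume (-Real.pi) Real.pi)
    (hh : IntervalIntegrable h volume (-Real.pi) Real.pi)
    (hle : ∀ x ∈ Set.Icc (-Real.pi) Real.pi, ‖g x‖ ≤ h x) :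
    l1Norm g ≤ ∫ x in (-Real.pi)..Real.pi, h x :=
  intervalIntegral.integral_mono_on neg_pi_le_pi hg.norm hh hle

theorem l1Norm_add_le {g h : ℝ → ℂ} (hg : IntervalIntegrable g volume (-Real.pi) Real.pi)
    (hh : IntervalIntegrable h volume (-Real.pi) Real.pi) :
    l1Norm (fun x => g x + h x) ≤ l1Norm g + l1Norm h := by
  unfold l1Norm
  rw [← intervalIntegral.integral_add hg.norm hh.norm]
  exact l1Norm_mono_of_norm_le (hg.add hh) (hg.norm.add hh.norm) fun x _ => norm_add_le _ _

theorem l1Norm_sum_le {ι : Type*} (s : Finset ι) {g : ι → ℝ → ℂ}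
    (hg : ∀ i ∈ s, IntervalIntegrable (g i) volume (-Real.pi) Real.pi) :
    l1Norm (fun x => ∑ i ∈ s, g i x) ≤ ∑ i ∈ s, l1Norm (g i) := by
  unfold l1Norm
  rw [← intervalIntegral.integral_finsetSum fun i hi => (hg i hi).norm]
  refine l1Norm_mono_of_norm_le ?_ ?_ fun x _ => norm_sum_le _ _
  · simpa [Finset.sum_fn] using IntervalIntegrable.sum s hg
  · simpa [Finset.sum_fn] using IntervalIntegrable.sum s fun i hi => (hg i hi).norm

theorem l1Norm_const_mul (c : ℂ) (g : ℝ → ℂ) :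
    l1Norm (fun x => c * g x) = ‖c‖ * l1Norm g := by
  simp [l1Norm]

theorem l1Norm_comp_neg (g : ℝ → ℂ) : l1Norm (fun x => g (-x)) = l1Norm g := by
  unfold l1Norm
  rw [intervalIntegral.integral_comp_neg fun x => ‖g x‖]
  simp

theorem l1Norm_neg (g : ℝ → ℂ) : l1Norm (fun x => -g x) = l1Norm g := by
  simp [l1Norm]

/-! ### Logarithmic `L¹` bounds for exponential sums and blocks. -/

/-- The exponential sum `∑_{0 ≤ l < N} e^{ilx}`. -/
def expSum (N : ℕ) (x : ℝ) : ℂ := ∑ l ∈ Finset.range N, wave l x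

@[fun_prop]
theorem continuous_expSum (N : ℕ) : Continuous (expSum N) := by
  unfold expSum; fun_prop

theorem norm_expSum_le (N : ℕ) (x : ℝ) : ‖expSum N x‖ ≤ N := by
  refine (norm_sum_le _ _).trans ?_
  simp [norm_wave]

theorem abs_div_pi_le_norm_wave_one_sub_one {x : ℝ} (hx : |x| ≤ Real.pi) :
    2 * |x| / Real.pi ≤ ‖wave 1 x - 1‖ := by
  have h : ‖wave 1 x - 1‖ = ‖2 * Real.sin (x / 2)‖ := by
    rw [← Complex.norm_exp_I_mul_ofReal_sub_one]; simp [wave]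
  rw [h, norm_mul, Real.norm_eq_abs, Real.norm_eq_abs, abs_two]
  have := Real.mul_abs_le_abs_sin (x := x / 2) (by rw [abs_div, abs_two]; linarith)
  rw [abs_div, abs_two] at this
  calc 2 * |x| / Real.pi = 2 * (2 / Real.pi * (|x| / 2)) := by ring
    _ ≤ _ := by linarith

/-- Multiplying by `e^{ix} - 1` telescopes the geometric sum, and Jordan's inequality bounds that
factor below by `2|x|/π`. -/
theorem abs_mul_norm_expSum_le (N : ℕ) {x : ℝ} (hx : |x| ≤ Real.pi) :
    |x| * ‖expSum N x‖ ≤ Real.pi := by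
  have hg : expSum N x * (wave 1 x - 1) = wave N x - 1 := by
    rw [expSum]
    induction N with
    | zero => simp [wave_zero]
    | succ n ih =>
      rw [Finset.sum_range_succ, add_mul, ih]
      push_cast
      rw [wave_add]
      ring
  have h2 : ‖expSum N x‖ * ‖wave 1 x - 1‖ ≤ 2 := by
    rw [← norm_mul, hg]
    refine (norm_sub_le _ _).trans ?_
    rw [norm_wave]; norm_num
  have h3 := mul_le_mul_of_nonneg_left (abs_div_pi_le_norm_wave_one_sub_one hx)
    (norm_nonneg (expSum N x))
  have h4 : ‖expSum N x‖ * (2 * |x| / Real.pi) ≤ 2 := h3.trans h2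
  rw [mul_div_assoc', div_le_iff₀ Real.pi_pos] at h4
  linarith

theorem l1Norm_expSum_le (N : ℕ) :
    l1Norm (expSum N) ≤ 4 * Real.pi * Real.log (N + 1) := by
  have hpi := Real.pi_pos
  -- Adding `N` times `|x|‖E‖ ≤ π` to `π` times `‖E‖ ≤ N`, where `E = expSum N x`, gives this
  -- majorant. It covers all `x` at once and has an elementary primitive on each side of `0`.
  let h : ℝ → ℝ := fun x => 2 * Real.pi * N / (N * |x| + Real.pi)
  have hcont : Continuous h := by
    refine Continuous.div (by fun_prop) (by fun_prop) fun x => ?_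
    positivity
  have hle : l1Norm (expSum N) ≤ ∫ x in (-Real.pi)..Real.pi, h x := by
    refine l1Norm_mono_of_norm_le ((continuous_expSum N).intervalIntegrable _ _)
      (hcont.intervalIntegrable _ _) fun x hx => ?_
    have hx' : |x| ≤ Real.pi := abs_le.2 hx
    rw [le_div_iff₀ (by positivity)]
    have h1 := mul_le_mul_of_nonneg_left (abs_mul_norm_expSum_le N hx') (Nat.cast_nonneg N)
    have h2 := mul_le_mul_of_nonneg_left (norm_expSum_le N x) hpi.le
    nlinarith
  have hright : ∫ x in (0 : ℝ)..Real.pi, h x = 2 * Real.pi * Real.log (N + 1) := by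
    have hder : ∀ x ∈ Set.uIcc 0 Real.pi,
        HasDerivAt (fun x : ℝ => 2 * Real.pi * Real.log (N * x + Real.pi)) (h x) x := by
      intro x hx
      rw [Set.uIcc_of_le hpi.le] at hx
      have hpos : (N : ℝ) * x + Real.pi ≠ 0 := by
        have := hx.1
        positivity
      have := ((((hasDerivAt_id x).const_mul (N : ℝ)).add_const Real.pi).log hpos).const_mul
        (2 * Real.pi)
      refine this.congr_deriv ?_
      simp only [h, abs_of_nonneg hx.1, id]
      ring
    rw [intervalIntegral.integral_eq_sub_of_hasDerivAt hder (hcont.intervalIntegrable _ _),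
      ← mul_sub, mul_zero, zero_add, ← Real.log_div (by positivity) hpi.ne']
    congr 2
    field_simp
  have hleft : ∫ x in (-Real.pi)..0, h x = ∫ x in (0 : ℝ)..Real.pi, h x := by
    have := intervalIntegral.integral_comp_neg (a := -Real.pi) (b := 0) h
    simp only [neg_zero, neg_neg] at this
    rw [← this]
    simp [h]
  have hsplit := intervalIntegral.integral_add_adjacent_intervals
    (hcont.intervalIntegrable (μ := volume) (-Real.pi) 0) (hcont.intervalIntegrable 0 Real.pi)
  rw [hleft, hright] at hsplit
  linarith

theorem sum_mul_eq_by_parts (a z : ℕ → ℂ) (N : ℕ) :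
    ∑ l ∈ Finset.range (N + 1), a l * z l
      = a N * ∑ l ∈ Finset.range (N + 1), z l
        + ∑ l ∈ Finset.range N, (a l - a (l + 1)) * ∑ i ∈ Finset.range (l + 1), z i := by
  induction N with
  | zero => simp
  | succ n ih =>
    rw [Finset.sum_range_succ, ih, Finset.sum_range_succ z (n + 1),
      Finset.sum_range_succ (fun l => (a l - a (l + 1)) * ∑ i ∈ Finset.range (l + 1), z i) n]
    ring

theorem sum_wave_add (n : ℤ) (N : ℕ) (x : ℝ) :
    ∑ l ∈ Finset.range N, wave (n + l) x = wave n x * expSum N x := by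
  simp only [wave_add, expSum, Finset.mul_sum]

/-- The `L¹` norm of a block of exponentials is controlled by the variation of the coefficients. -/
theorem l1Norm_block_le (a : ℕ → ℂ) (n : ℤ) (N : ℕ) :
    l1Norm (fun x => ∑ l ∈ Finset.range (N + 1), a l * wave (n + l) x)
      ≤ (‖a N‖ + ∑ l ∈ Finset.range N, ‖a l - a (l + 1)‖)
        * (4 * Real.pi * Real.log (N + 2)) := by
  have hB : ∀ (b : ℂ) (j : ℕ), j ≤ N →
      l1Norm (fun x => b * (wave n x * expSum (j + 1) x))
        ≤ ‖b‖ * (4 * Real.pi * Real.log (N + 2)) := by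
    intro b j hj
    rw [l1Norm_const_mul b]
    have h1 : l1Norm (fun x => wave n x * expSum (j + 1) x) = l1Norm (expSum (j + 1)) := by
      simp [l1Norm, norm_wave]
    rw [h1]
    refine mul_le_mul_of_nonneg_left ((l1Norm_expSum_le _).trans ?_) (norm_nonneg _)
    have hj' : (j : ℝ) ≤ N := by exact_mod_cast hj
    have : Real.log ((j + 1 : ℕ) + 1) ≤ Real.log (N + 2) := by
      apply Real.log_le_log (by positivity)
      push_cast
      linarith
    have := Real.pi_pos
    gcongr
  have hI : ∀ (b : ℂ) (j : ℕ), IntervalIntegrable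
      (fun x => b * (wave n x * expSum (j + 1) x)) volume (-Real.pi) Real.pi := fun b j =>
    Continuous.intervalIntegrable (by fun_prop) _ _
  simp only [sum_mul_eq_by_parts, sum_wave_add]
  refine (l1Norm_add_le (hI _ _) (Continuous.intervalIntegrable (by fun_prop) _ _)).trans ?_
  rw [add_mul, Finset.sum_mul]
  refine add_le_add (hB _ _ le_rfl) ?_
  refine (l1Norm_sum_le _ fun l _ => hI _ _).trans (Finset.sum_le_sum fun l hl => ?_)
  exact hB _ _ (Finset.mem_range.1 hl).le

/-! ### Fourier coefficients and orthogonality. -/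

theorem coeff_eq_integral_wave (f : ℝ → ℂ) (n : ℤ) :
    coeff f n = (1 / (2 * Real.pi) : ℂ) * ∫ x in (-Real.pi)..Real.pi, wave (-n) x * f x := by
  rw [coeff_eq_integral, Complex.real_smul]
  congr 1
  · push_cast; ring
  · refine intervalIntegral.integral_congr fun x _ => ?_
    simp [wave]

theorem integral_wave_neg_mul (f : ℝ → ℂ) (n : ℤ) :
    ∫ x in (-Real.pi)..Real.pi, wave (-n) x * f x = 2 * Real.pi * coeff f n := by
  have : (Real.pi : ℂ) ≠ 0 := by exact_mod_cast Real.pi_ne_zero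
  rw [coeff_eq_integral_wave]
  field_simp

theorem partialSum_eq (f : ℝ → ℂ) (n : ℕ) (x : ℝ) :
    partialSum f n x = ∑ k ∈ Finset.Icc (-(n : ℤ)) n, coeff f k * wave k x := rfl

@[fun_prop]
theorem continuous_partialSum (f : ℝ → ℂ) (n : ℕ) : Continuous (partialSum f n) := by
  have : partialSum f n = fun x => ∑ k ∈ Finset.Icc (-(n : ℤ)) n, coeff f k * wave k x := rfl
  rw [this]
  fun_prop

theorem intervalIntegrable_wave_mul {f : ℝ → ℂ}
    (hf : IntervalIntegrable f volume (-Real.pi) Real.pi) (k : ℤ) :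
    IntervalIntegrable (fun x => wave k x * f x) volume (-Real.pi) Real.pi :=
  hf.continuousOn_mul (continuous_wave k).continuousOn

theorem integral_wave_mul_trigPoly (s : Finset ℤ) (a : ℤ → ℂ) (n : ℤ) :
    ∫ x in (-Real.pi)..Real.pi, wave (-n) x * ∑ k ∈ s, a k * wave k x
      = if n ∈ s then 2 * Real.pi * a n else 0 := by
  have h : ∀ x, wave (-n) x * ∑ k ∈ s, a k * wave k x = ∑ k ∈ s, a k * wave (k - n) x := by
    intro x
    rw [Finset.mul_sum]
    refine Finset.sum_congr rfl fun k _ => ?_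
    rw [sub_eq_add_neg, wave_add]
    ring
  simp only [h]
  rw [intervalIntegral.integral_finsetSum fun k _ =>
    Continuous.intervalIntegrable (by fun_prop) _ _]
  simp only [intervalIntegral.integral_const_mul]
  have h2 : ∀ k ∈ s, a k * ∫ x in (-Real.pi)..Real.pi, wave (k - n) x
      = if n = k then 2 * Real.pi * a n else 0 := by
    intro k _
    split_ifs with hk
    · subst hk
      rw [sub_self, integral_wave_zero]
      ring
    · rw [integral_wave_of_ne (sub_ne_zero.2 (Ne.symm hk)), mul_zero]
  rw [Finset.sum_congr rfl h2, Finset.sum_ite_eq]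

theorem integral_wave_mul_sub_partialSum {f : ℝ → ℂ}
    (hf : IntervalIntegrable f volume (-Real.pi) Real.pi) (n : ℕ) (k : ℤ) :
    ∫ x in (-Real.pi)..Real.pi, wave (-k) x * (f x - partialSum f n x)
      = if k ∈ Finset.Icc (-(n : ℤ)) n then 0 else 2 * Real.pi * coeff f k := by
  simp only [mul_sub]
  rw [intervalIntegral.integral_sub (intervalIntegrable_wave_mul hf _)
    (Continuous.intervalIntegrable (by fun_prop) _ _), integral_wave_neg_mul]
  simp only [partialSum_eq]
  rw [integral_wave_mul_trigPoly]
  split_ifs <;> simp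

/-! ### Bounded sine polynomials and the duality estimate. -/

/-- Abel summation: the partial sums of the exponentials are at most `π/|x|`, and the weights
decrease, so their variation telescopes to the first weight `1/(K+1)`. -/
theorem norm_sum_wave_div_le (K T : ℕ) {x : ℝ} (hx0 : 0 < |x|) (hx : |x| ≤ Real.pi) :
    ‖∑ l ∈ Finset.range T, ((1 / (K + l + 1 : ℝ) : ℝ) : ℂ) * wave (K + 1 + l) x‖
      ≤ Real.pi / (|x| * (K + 1)) := by
  have hpi := Real.pi_pos
  rcases T with _ | T
  · simp only [Finset.range_zero, Finset.sum_empty, norm_zero]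
    positivity
  have hE : ∀ j, ‖expSum j x‖ ≤ Real.pi / |x| := fun j => by
    rw [le_div_iff₀ hx0, mul_comm]
    exact abs_mul_norm_expSum_le j hx
  rw [sum_mul_eq_by_parts (fun l => ((1 / (K + l + 1 : ℝ) : ℝ) : ℂ))
    (fun l => wave (K + 1 + l) x)]
  simp only [sum_wave_add]
  have hterm : ∀ l : ℕ, ‖((1 / (K + l + 1 : ℝ) : ℝ) : ℂ) - ((1 / (K + (l + 1 : ℕ) + 1 : ℝ) : ℝ) : ℂ)‖
      = 1 / (K + l + 1 : ℝ) - 1 / (K + (l + 1 : ℕ) + 1 : ℝ) := by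
    intro l
    rw [← Complex.ofReal_sub, Complex.norm_real, Real.norm_eq_abs, abs_of_nonneg]
    rw [sub_nonneg]
    apply one_div_le_one_div_of_le (by positivity)
    push_cast
    linarith
  have hlast : ‖((1 / (K + T + 1 : ℝ) : ℝ) : ℂ)‖ = 1 / (K + T + 1 : ℝ) := by
    rw [Complex.norm_real, Real.norm_eq_abs, abs_of_nonneg (by positivity)]
  refine (norm_add_le _ _).trans ?_
  have h1 : ‖((1 / (K + T + 1 : ℝ) : ℝ) : ℂ) * (wave (K + 1) x * expSum (T + 1) x)‖
      ≤ 1 / (K + T + 1 : ℝ) * (Real.pi / |x|) := by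
    rw [norm_mul, norm_mul, norm_wave, one_mul, hlast]
    exact mul_le_mul_of_nonneg_left (hE _) (by positivity)
  have h2 : ‖∑ l ∈ Finset.range T,
      (((1 / (K + l + 1 : ℝ) : ℝ) : ℂ) - ((1 / (K + (l + 1 : ℕ) + 1 : ℝ) : ℝ) : ℂ))
        * (wave (K + 1) x * expSum (l + 1) x)‖
      ≤ (1 / (K + (0 : ℕ) + 1 : ℝ) - 1 / (K + T + 1 : ℝ)) * (Real.pi / |x|) := by
    rw [← Finset.sum_range_sub' (fun l : ℕ => 1 / (K + l + 1 : ℝ)) T, Finset.sum_mul]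
    refine (norm_sum_le _ _).trans (Finset.sum_le_sum fun l _ => ?_)
    rw [norm_mul, norm_mul, norm_wave, one_mul, ← hterm]
    exact mul_le_mul_of_nonneg_left (hE _) (norm_nonneg _)
  refine (add_le_add h1 h2).trans (le_of_eq ?_)
  rw [← add_mul]
  push_cast
  field_simp
  ring

/-- The trigonometric polynomial `2i ∑_{k=1}^{N} sin(kx)/k`. -/
def sineSum (N : ℕ) (x : ℝ) : ℂ :=
  ∑ k ∈ Finset.range N, ((1 / (k + 1 : ℝ) : ℝ) : ℂ) * (wave (k + 1) x - wave (-(k + 1)) x)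

theorem norm_sineSum_le_mul (N : ℕ) (x : ℝ) : ‖sineSum N x‖ ≤ 2 * (N * |x|) := by
  refine (norm_sum_le _ _).trans ?_
  have : ∀ k ∈ Finset.range N,
      ‖((1 / (k + 1 : ℝ) : ℝ) : ℂ) * (wave (k + 1) x - wave (-(k + 1)) x)‖ ≤ 2 * |x| := by
    intro k _
    have h : wave (k + 1) x - wave (-(k + 1)) x
        = wave (-(k + 1)) x * (wave (2 * (k + 1)) x - 1) := by
      rw [mul_sub, ← wave_add, mul_one]
      ring_nf
    have h2 : ‖wave (2 * (k + 1)) x - 1‖ ≤ 2 * (k + 1) * |x| := by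
      have := Real.norm_exp_I_mul_ofReal_sub_one_le (x := 2 * (k + 1) * x)
      rw [Real.norm_eq_abs, abs_mul, abs_of_nonneg (by positivity : (0 : ℝ) ≤ 2 * (k + 1))] at this
      convert this using 3
      simp [wave, mul_assoc]
    rw [h, norm_mul, norm_mul, norm_wave, one_mul, Complex.norm_real, Real.norm_eq_abs,
      abs_of_nonneg (by positivity)]
    calc 1 / (k + 1 : ℝ) * ‖wave (2 * (k + 1)) x - 1‖
        ≤ 1 / (k + 1 : ℝ) * (2 * (k + 1) * |x|) :=
          mul_le_mul_of_nonneg_left h2 (by positivity)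
      _ = 2 * |x| := by field_simp
  refine (Finset.sum_le_sum this).trans (le_of_eq ?_)
  simp
  ring

theorem norm_sineSum_le (N : ℕ) {x : ℝ} (hx : |x| ≤ Real.pi) :
    ‖sineSum N x‖ ≤ 2 * (Real.pi + 1) := by
  have hpi := Real.pi_pos
  rcases (abs_nonneg x).eq_or_lt with h0 | h0
  · refine (norm_sineSum_le_mul N x).trans ?_
    rw [← h0]
    linarith
  -- Cutting at `1/|x|` balances the two estimates: the head is at most `2K|x| ≤ 2`, and each half
  -- of the tail at most `π/(|x|(K+1)) ≤ π`.
  set K := ⌊1 / |x|⌋₊ with hK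
  have hK1 : K * |x| ≤ 1 := by
    have := Nat.floor_le (by positivity : 0 ≤ 1 / |x|)
    rwa [le_div_iff₀ h0] at this
  have hK2 : 1 ≤ |x| * (K + 1) := by
    have := (Nat.lt_floor_add_one (1 / |x|)).le
    rw [div_le_iff₀ h0] at this
    linarith
  rcases le_total N K with hNK | hNK
  · refine (norm_sineSum_le_mul N x).trans ?_
    have : (N : ℝ) * |x| ≤ K * |x| := by gcongr
    linarith
  obtain ⟨T, rfl⟩ := Nat.exists_eq_add_of_le hNK
  have hsplit : sineSum (K + T) x = sineSum K x
      + (∑ l ∈ Finset.range T, ((1 / (K + l + 1 : ℝ) : ℝ) : ℂ) * wave (K + 1 + l) x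
        - ∑ l ∈ Finset.range T, ((1 / (K + l + 1 : ℝ) : ℝ) : ℂ) * wave (K + 1 + l) (-x)) := by
    rw [sineSum, Finset.sum_range_add, sineSum, ← Finset.sum_sub_distrib]
    congr 1
    refine Finset.sum_congr rfl fun l _ => ?_
    rw [wave_neg_apply]
    push_cast
    rw [show (K + l + 1 : ℤ) = K + 1 + l by ring]
    ring
  have htail : Real.pi / (|x| * (K + 1)) ≤ Real.pi := div_le_self hpi.le hK2
  rw [hsplit]
  refine (norm_add_le _ _).trans ?_
  have h1 := norm_sineSum_le_mul K x
  have h2 := norm_sub_le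
    (∑ l ∈ Finset.range T, ((1 / (K + l + 1 : ℝ) : ℝ) : ℂ) * wave (K + 1 + l) x)
    (∑ l ∈ Finset.range T, ((1 / (K + l + 1 : ℝ) : ℝ) : ℂ) * wave (K + 1 + l) (-x))
  have h3 := norm_sum_wave_div_le K T h0 hx
  have h4 := norm_sum_wave_div_le K T (x := -x) (by rwa [abs_neg]) (by rwa [abs_neg])
  rw [abs_neg] at h4
  linarith

theorem norm_sum_coeff_div_le {f : ℝ → ℂ}
    (hf : IntervalIntegrable f volume (-Real.pi) Real.pi) (n : ℕ) :
    ‖∑ k ∈ Finset.range (2 * n), ((1 / (k + 1 : ℝ) : ℝ) : ℂ) * coeff f ((n + k + 1 : ℕ) : ℤ)‖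
      ≤ (Real.pi + 1) / Real.pi * l1Norm (fun x => f x - partialSum f n x) := by
  have hpi := Real.pi_pos
  set g : ℝ → ℂ := fun x => f x - partialSum f n x with hg
  have hgI : IntervalIntegrable g volume (-Real.pi) Real.pi :=
    hf.sub (Continuous.intervalIntegrable (by fun_prop) _ _)
  have hkey : ∫ x in (-Real.pi)..Real.pi, wave (-n) x * sineSum (2 * n) x * g x
      = -(2 * Real.pi) * ∑ k ∈ Finset.range (2 * n),
        ((1 / (k + 1 : ℝ) : ℝ) : ℂ) * coeff f ((n + k + 1 : ℕ) : ℤ) := by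
    have hexp : ∀ x, wave (-n) x * sineSum (2 * n) x * g x
        = ∑ k ∈ Finset.range (2 * n), ((1 / (k + 1 : ℝ) : ℝ) : ℂ) *
          (wave (-(n - k - 1)) x * g x - wave (-((n + k + 1 : ℕ) : ℤ)) x * g x) := by
      intro x
      rw [sineSum, Finset.mul_sum, Finset.sum_mul]
      refine Finset.sum_congr rfl fun k _ => ?_
      rw [show (-(n - k - 1) : ℤ) = -n + (k + 1) by ring,
        show (-((n + k + 1 : ℕ) : ℤ)) = -n + -(k + 1) by push_cast; ring,
        wave_add (-n), wave_add (-n)]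
      ring
    simp only [hexp]
    rw [intervalIntegral.integral_finsetSum fun k _ =>
      ((intervalIntegrable_wave_mul hgI _).sub (intervalIntegrable_wave_mul hgI _)).const_mul _,
      Finset.mul_sum]
    -- For `k < 2n` the frequency `n-k-1` stays in `[-n, n]`, where `f - S_n` has zero coefficient,
    -- while `n+k+1` lies outside. The length `2n` is the largest for which this works.
    refine Finset.sum_congr rfl fun k hk => ?_
    rw [Finset.mem_range] at hk
    rw [intervalIntegral.integral_const_mul, intervalIntegral.integral_sub
      (intervalIntegrable_wave_mul hgI _) (intervalIntegrable_wave_mul hgI _),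
      integral_wave_mul_sub_partialSum hf, integral_wave_mul_sub_partialSum hf,
      if_pos (by rw [Finset.mem_Icc]; omega), if_neg (by rw [Finset.mem_Icc]; omega)]
    ring
  have hb : ‖∫ x in (-Real.pi)..Real.pi, wave (-n) x * sineSum (2 * n) x * g x‖
      ≤ ∫ x in (-Real.pi)..Real.pi, 2 * (Real.pi + 1) * ‖g x‖ := by
    refine intervalIntegral.norm_integral_le_of_norm_le neg_pi_le_pi ?_ (hgI.norm.const_mul _)
    refine Eventually.of_forall fun x hx => ?_
    rw [norm_mul, norm_mul, norm_wave, one_mul]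
    exact mul_le_mul_of_nonneg_right (norm_sineSum_le _ (abs_le.2 ⟨hx.1.le, hx.2⟩)) (norm_nonneg _)
  rw [hkey, intervalIntegral.integral_const_mul, norm_mul, norm_neg, norm_mul, Complex.norm_real,
    Real.norm_eq_abs, abs_of_pos hpi] at hb
  have h2 : ‖(2 : ℂ)‖ = 2 := by simp
  rw [h2] at hb
  rw [div_mul_eq_mul_div, le_div_iff₀ hpi]
  change _ ≤ 2 * (Real.pi + 1) * l1Norm g at hb
  linarith

/-! ### Sector and variation conditions; necessity. -/

theorem cos_mul_norm_le_re {θ : ℝ} (hθ : θ < Real.pi / 2) {z : ℂ}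
    (hz : z ∈ sector θ) : Real.cos θ * ‖z‖ ≤ z.re := by
  have hz' : |Complex.arg z| ≤ θ := hz
  have h := Real.cos_le_cos_of_nonneg_of_le_pi (abs_nonneg _)
    (by linarith [Real.pi_pos] : θ ≤ Real.pi) hz'
  rw [Real.cos_abs] at h
  rw [← Complex.norm_mul_cos_arg, mul_comm]
  exact mul_le_mul_of_nonneg_left h (norm_nonneg _)

theorem cos_mul_sum_norm_le {ι : Type*} {θ : ℝ} (hθ : θ < Real.pi / 2) (s : Finset ι)
    {w : ι → ℝ} {c : ι → ℂ} (hw : ∀ i ∈ s, 0 ≤ w i) (hc : ∀ i ∈ s, c i ∈ sector θ) :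
    Real.cos θ * ∑ i ∈ s, w i * ‖c i‖ ≤ ‖∑ i ∈ s, (w i : ℂ) * c i‖ := by
  refine le_trans ?_ (Complex.re_le_norm _)
  rw [Complex.re_sum, Finset.mul_sum]
  refine Finset.sum_le_sum fun i hi => ?_
  rw [Complex.re_ofReal_mul]
  have := mul_le_mul_of_nonneg_left (cos_mul_norm_le_re hθ (hc i hi)) (hw i hi)
  linarith

/-- The path from `m` to `j` uses only differences counted in the variation. The last one, `c (2m) -
c (2m+1)`, is what admits `j = 2m+1`. The maximum is relaxed to a sum so that it can later be
averaged over `m`. -/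
theorem norm_le_of_variation_le {c : ℕ → ℂ} {N₀ m j : ℕ} {M : ℝ} (hN : 1 ≤ N₀) (hM : 0 < M)
    (hvar : ∑ n ∈ Finset.Icc m (2 * m), ‖c n - c (n + 1)‖ ≤
      M * ((Finset.Ico m (m + N₀)).sup (fun n => ‖c n‖₊) : NNReal))
    (hmj : m ≤ j) (hj : j ≤ 2 * m + 1) :
    ‖c j‖ ≤ (M + 1) * ∑ i ∈ Finset.range N₀, ‖c (m + i)‖ := by
  have hsup : (((Finset.Ico m (m + N₀)).sup (fun n => ‖c n‖₊) : NNReal) : ℝ)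
      ≤ ∑ i ∈ Finset.range N₀, ‖c (m + i)‖ := by
    have h : (Finset.Ico m (m + N₀)).sup (fun n => ‖c n‖₊)
        ≤ ∑ i ∈ Finset.range N₀, ‖c (m + i)‖₊ := by
      refine Finset.sup_le fun n hn => ?_
      rw [Finset.mem_Ico] at hn
      have := Finset.single_le_sum (f := fun i => ‖c (m + i)‖₊) (fun i _ => zero_le)
        (Finset.mem_range.2 (by omega : n - m < N₀))
      simpa [Nat.add_sub_cancel' hn.1] using this
    have h' := NNReal.coe_le_coe.2 h
    rwa [NNReal.coe_sum] at h'
  have hm : ‖c m‖ ≤ ∑ i ∈ Finset.range N₀, ‖c (m + i)‖ :=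
    Finset.single_le_sum (f := fun i => ‖c (m + i)‖) (fun i _ => norm_nonneg _)
        (Finset.mem_range.2 (by omega : 0 < N₀))
  have hd : ‖c m - c j‖ ≤ ∑ n ∈ Finset.Icc m (2 * m), ‖c n - c (n + 1)‖ := by
    have := dist_le_Ico_sum_dist c hmj
    simp only [dist_eq_norm] at this
    refine this.trans (Finset.sum_le_sum_of_subset_of_nonneg ?_ fun _ _ _ => norm_nonneg _)
    intro n hn
    rw [Finset.mem_Ico] at hn
    rw [Finset.mem_Icc]
    omega
  have htri : ‖c j‖ ≤ ‖c m‖ + ‖c m - c j‖ := by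
    have := norm_sub_le (c m) (c m - c j)
    simpa using this
  have := mul_le_mul_of_nonneg_left hsup hM.le
  linarith

theorem log_add_one_le_sum (n : ℕ) :
    Real.log (n + 1) ≤ ∑ k ∈ Finset.range n, 1 / (k + 1 : ℝ) := by
  have h := log_add_one_le_harmonic n
  simp only [harmonic] at h
  push_cast at h
  simpa using h

theorem sum_range_shift_le {b : ℕ → ℝ} (hb : ∀ k, 0 ≤ b k) {n i N : ℕ} (h : n + i ≤ N) :
    ∑ k ∈ Finset.range n, b (k + i) ≤ ∑ k ∈ Finset.range N, b k := by
  rw [Finset.range_eq_Ico, Finset.sum_Ico_add' b 0 n i, Finset.range_eq_Ico]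
  refine Finset.sum_le_sum_of_subset_of_nonneg (Finset.Ico_subset_Ico (Nat.zero_le _) h)
    fun k _ _ => hb k

/-- Every `m = n+k+1` with `k < n` satisfies `m ≤ j ≤ 2m+1`, so `‖c j‖` is controlled from each such
window; averaging with weights `1/(k+1)` produces the logarithm. -/
theorem norm_mul_log_le {c : ℕ → ℂ} {N₀ : ℕ} {M : ℝ} (hN : 1 ≤ N₀) (hM : 0 < M)
    (hvar : ∀ m : ℕ, 1 ≤ m → ∑ n ∈ Finset.Icc m (2 * m), ‖c n - c (n + 1)‖ ≤
      M * ((Finset.Ico m (m + N₀)).sup (fun n => ‖c n‖₊) : NNReal))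
    {n j : ℕ} (hn : N₀ ≤ n) (hj1 : 2 * n ≤ j) (hj2 : j ≤ 2 * n + 1) :
    ‖c j‖ * Real.log (n + 1) ≤ (M + 1) * (N₀ * (N₀ *
      ∑ k ∈ Finset.range (2 * n), 1 / (k + 1 : ℝ) * ‖c (n + k + 1)‖)) := by
  set b : ℕ → ℝ := fun k => 1 / (k + 1 : ℝ) * ‖c (n + k + 1)‖ with hb
  have hb0 : ∀ k, 0 ≤ b k := fun k => by positivity
  calc ‖c j‖ * Real.log (n + 1)
      ≤ ‖c j‖ * ∑ k ∈ Finset.range n, 1 / (k + 1 : ℝ) :=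
        mul_le_mul_of_nonneg_left (log_add_one_le_sum n) (norm_nonneg _)
    _ = ∑ k ∈ Finset.range n, 1 / (k + 1 : ℝ) * ‖c j‖ := by
        rw [Finset.mul_sum]; exact Finset.sum_congr rfl fun _ _ => mul_comm _ _
    _ ≤ ∑ k ∈ Finset.range n, (M + 1) * ∑ i ∈ Finset.range N₀, N₀ * b (k + i) := by
        refine Finset.sum_le_sum fun k hk => ?_
        rw [Finset.mem_range] at hk
        have h := norm_le_of_variation_le (j := j) hN hM (hvar (n + k + 1) (by omega))
          (by omega) (by omega)
        refine (mul_le_mul_of_nonneg_left h (by positivity)).trans ?_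
        rw [mul_left_comm, Finset.mul_sum]
        refine mul_le_mul_of_nonneg_left (Finset.sum_le_sum fun i hi => ?_) (by positivity)
        rw [Finset.mem_range] at hi
        simp only [hb]
        rw [show n + (k + i) + 1 = n + k + 1 + i by ring, ← mul_assoc]
        refine mul_le_mul_of_nonneg_right ?_ (norm_nonneg _)
        push_cast
        -- Moving the weight along the window costs a factor `N₀`: `k+i+1 ≤ N₀(k+1)`, since `i+1 ≤
        -- N₀`.
        rw [mul_one_div, div_le_div_iff₀ (by positivity) (by positivity)]
        have h1 : (i : ℝ) + 1 ≤ N₀ := by exact_mod_cast hi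
        have h2 : (1 : ℝ) ≤ N₀ := by exact_mod_cast hN
        have h3 : (0 : ℝ) ≤ k := Nat.cast_nonneg k
        nlinarith
    _ = (M + 1) * (N₀ * ∑ i ∈ Finset.range N₀, ∑ k ∈ Finset.range n, b (k + i)) := by
        rw [← Finset.mul_sum, Finset.sum_comm]
        simp only [← Finset.mul_sum]
    _ ≤ (M + 1) * (N₀ * ∑ i ∈ Finset.range N₀, ∑ k ∈ Finset.range (2 * n), b k) := by
        gcongr with i hi
        rw [Finset.mem_range] at hi
        -- The assumption `N₀ ≤ n` keeps the shifted indices below `2n`.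
        exact sum_range_shift_le hb0 (by omega)
    _ = _ := by
        rw [Finset.sum_const, Finset.card_range, nsmul_eq_mul]

theorem log_le_two_mul_log {n j : ℕ} (hj0 : 1 ≤ j) (hj2 : j ≤ 2 * n + 1) :
    Real.log j ≤ 2 * Real.log (n + 1) := by
  have : 2 * Real.log (n + 1) = Real.log ((n + 1 : ℝ) ^ 2) := by
    rw [Real.log_pow]; norm_num
  rw [this]
  have h0 : (1 : ℝ) ≤ j := by exact_mod_cast hj0
  have h1 : (j : ℝ) ≤ 2 * n + 1 := by exact_mod_cast hj2
  apply Real.log_le_log (by linarith)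
  nlinarith [sq_nonneg (n : ℝ)]

theorem IsGBV.tendsto_norm_mul_log {c : ℕ → ℂ} (hc : IsGBV c) {u : ℕ → ℝ}
    (hu : Tendsto u atTop (𝓝 0))
    (hcu : ∀ n : ℕ, ‖∑ k ∈ Finset.range (2 * n), ((1 / (k + 1 : ℝ) : ℝ) : ℂ) * c (n + k + 1)‖
      ≤ u n) :
    Tendsto (fun n : ℕ => ‖c n‖ * Real.log n) atTop (𝓝 0) := by
  obtain ⟨⟨θ, hθ0, hθ, hsec⟩, N₀, hN, M, hM, hvar⟩ := hc
  have hcos : 0 < Real.cos θ := Real.cos_pos_of_mem_Ioo ⟨by linarith [Real.pi_pos], hθ⟩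
  have hdiv : Tendsto (fun j : ℕ => j / 2) atTop atTop :=
    Nat.tendsto_div_const_atTop (by norm_num)
  have hlim : Tendsto (fun j : ℕ => 2 * ((M + 1) * (N₀ * (N₀ * (u (j / 2) / Real.cos θ)))))
      atTop (𝓝 0) := by
    have := ((((hu.comp hdiv).div_const (Real.cos θ)).const_mul (N₀ : ℝ)).const_mul
      (N₀ : ℝ)).const_mul (M + 1) |>.const_mul 2
    simpa using this
  refine squeeze_zero' ?_ ?_ hlim
  · exact Eventually.of_forall fun n => mul_nonneg (norm_nonneg _) (Real.log_natCast_nonneg n)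
  · filter_upwards [eventually_ge_atTop (2 * N₀)] with j hj
    -- With `n = j / 2` rounded down, `j` is `2n` or `2n+1`, so both parities are covered.
    have h1 := norm_mul_log_le hN hM hvar (n := j / 2) (j := j) (by omega) (by omega) (by omega)
    have h2 := cos_mul_sum_norm_le hθ (Finset.range (2 * (j / 2)))
      (w := fun k => 1 / (k + 1 : ℝ)) (c := fun k => c (j / 2 + k + 1))
      (fun k _ => by positivity) (fun k _ => hsec _ (by omega))
    have h3 := h2.trans (hcu (j / 2))
    rw [mul_comm, ← le_div_iff₀ hcos] at h3
    have h4 := log_le_two_mul_log (n := j / 2) (j := j) (by omega) (by omega)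
    calc ‖c j‖ * Real.log j ≤ ‖c j‖ * (2 * Real.log ((j / 2 : ℕ) + 1)) :=
          mul_le_mul_of_nonneg_left h4 (norm_nonneg _)
      _ = 2 * (‖c j‖ * Real.log ((j / 2 : ℕ) + 1)) := by ring
      _ ≤ 2 * _ := by
        refine mul_le_mul_of_nonneg_left (h1.trans ?_) (by norm_num)
        gcongr

theorem tendsto_coeff_log_of_tendsto_l1Norm {f : ℝ → ℂ}
    (hf : IntervalIntegrable f volume (-Real.pi) Real.pi)
    (hc : IsGBV (fun n : ℕ => coeff f (n : ℤ)))
    (h : Tendsto (fun n : ℕ => l1Norm (fun x => f x - partialSum f n x)) atTop (𝓝 0)) :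
    Tendsto (fun n : ℕ => ‖coeff f (n : ℤ)‖ * Real.log n) atTop (𝓝 0) := by
  refine hc.tendsto_norm_mul_log (u := fun n => (Real.pi + 1) / Real.pi *
    l1Norm (fun x => f x - partialSum f n x)) ?_ (norm_sum_coeff_div_le hf)
  simpa using h.const_mul ((Real.pi + 1) / Real.pi)

theorem coeff_comp_neg (f : ℝ → ℂ) (n : ℤ) : coeff (fun x => f (-x)) n = coeff f (-n) := by
  rw [coeff_eq_integral_wave, coeff_eq_integral_wave]
  congr 1
  have := intervalIntegral.integral_comp_neg (a := -Real.pi) (b := Real.pi)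
    (fun x => wave (- -n) x * f x)
  rw [neg_neg Real.pi] at this
  rw [← this]
  simp only [wave_neg_apply, neg_neg]

theorem partialSum_comp_neg (f : ℝ → ℂ) (n : ℕ) (x : ℝ) :
    partialSum (fun x => f (-x)) n x = partialSum f n (-x) := by
  rw [partialSum_eq, partialSum_eq]
  refine Finset.sum_nbij' (fun k => -k) (fun k => -k) ?_ ?_ ?_ ?_ ?_
  · intro k hk; rw [Finset.mem_Icc] at *; omega
  · intro k hk; rw [Finset.mem_Icc] at *; omega
  · intro k _; exact neg_neg k
  · intro k _; exact neg_neg k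
  · intro k _
    rw [coeff_comp_neg, wave_neg_apply, neg_neg]

theorem tendsto_coeff_neg_log_of_tendsto_l1Norm {f : ℝ → ℂ}
    (hf : IntervalIntegrable f volume (-Real.pi) Real.pi)
    (hc : IsGBV (fun n : ℕ => coeff f (-(n : ℤ))))
    (h : Tendsto (fun n : ℕ => l1Norm (fun x => f x - partialSum f n x)) atTop (𝓝 0)) :
    Tendsto (fun n : ℕ => ‖coeff f (-(n : ℤ))‖ * Real.log n) atTop (𝓝 0) := by
  have hf' : IntervalIntegrable (fun x => f (-x)) volume (-Real.pi) Real.pi := by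
    have := hf.symm.comp_sub_left 0
    simpa using this
  have := tendsto_coeff_log_of_tendsto_l1Norm (f := fun x => f (-x)) hf'
    (by simpa only [coeff_comp_neg] using hc) (by
      simp only [partialSum_comp_neg]
      exact h.congr fun n => (l1Norm_comp_neg fun x => f x - partialSum f n x).symm)
  simpa only [coeff_comp_neg] using this

/-! ### Dirichlet, Fejér and de la Vallée Poussin kernels. -/

theorem sum_Icc_neg_succ (F : ℤ → ℂ) (n : ℕ) :
    ∑ k ∈ Finset.Icc (-((n + 1 : ℕ) : ℤ)) ((n + 1 : ℕ) : ℤ), F k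
      = ∑ k ∈ Finset.Icc (-(n : ℤ)) n, F k + (F (n + 1) + F (-(n + 1))) := by
  have h : Finset.Icc (-((n + 1 : ℕ) : ℤ)) ((n + 1 : ℕ) : ℤ)
      = insert (n + 1 : ℤ) (insert (-(n + 1) : ℤ) (Finset.Icc (-(n : ℤ)) n)) := by
    ext k
    simp only [Finset.mem_Icc, Finset.mem_insert]
    omega
  rw [h, Finset.sum_insert, Finset.sum_insert]
  · ring
  · rw [Finset.mem_Icc]; omega
  · rw [Finset.mem_insert, Finset.mem_Icc]; omega

theorem sum_Icc_neg_add (F : ℤ → ℂ) (n N : ℕ) :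
    ∑ k ∈ Finset.Icc (-((n + N : ℕ) : ℤ)) ((n + N : ℕ) : ℤ), F k
      = ∑ k ∈ Finset.Icc (-(n : ℤ)) n, F k
        + ∑ l ∈ Finset.range N, (F (n + 1 + l) + F (-(n + 1 + l))) := by
  induction N with
  | zero => simp
  | succ N ih =>
    rw [← add_assoc, sum_Icc_neg_succ, ih, Finset.sum_range_succ, add_assoc]
    push_cast
    rw [add_right_comm (n : ℤ) N 1]

/-- The Dirichlet kernel. -/
def dirichletKernel (m : ℕ) (y : ℝ) : ℂ := ∑ k ∈ Finset.Icc (-(m : ℤ)) m, wave k y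

@[fun_prop]
theorem continuous_dirichletKernel (m : ℕ) : Continuous (dirichletKernel m) := by
  unfold dirichletKernel; fun_prop

theorem integral_dirichletKernel (m : ℕ) :
    ∫ x in (-Real.pi)..Real.pi, dirichletKernel m x = 2 * Real.pi := by
  have h := integral_wave_mul_trigPoly (Finset.Icc (-(m : ℤ)) m) (fun _ => 1) 0
  rw [if_pos (by rw [Finset.mem_Icc]; omega)] at h
  simpa [wave_zero, dirichletKernel] using h

/-- The right side is the increment `|E + e^{iNy}|² - |E|²` with `E = expSum N y`, which makes the
Fejér sum telescope. -/
theorem dirichletKernel_eq (N : ℕ) (y : ℝ) :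
    dirichletKernel N y = expSum N y * wave (-N) y + wave N y * (starRingEnd ℂ) (expSum N y) + 1 := by
  have h := sum_Icc_neg_add (fun k => wave k y) 0 N
  simp only [Nat.cast_zero, neg_zero, Finset.Icc_self, Finset.sum_singleton, zero_add,
    wave_zero] at h
  rw [dirichletKernel, h, expSum, map_sum, Finset.sum_mul, Finset.mul_sum, ← Finset.sum_add_distrib,
    ← Finset.sum_range_reflect, add_comm]
  congr 1
  refine Finset.sum_congr rfl fun k hk => ?_
  rw [Finset.mem_range] at hk
  rw [conj_wave, ← wave_add, ← wave_add,
    show (1 + ((N - 1 - k : ℕ) : ℤ)) = N - k by omega, add_comm]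
  congr 2; ring

theorem sum_dirichletKernel (N : ℕ) (y : ℝ) :
    ∑ m ∈ Finset.range N, dirichletKernel m y = ((‖expSum N y‖ ^ 2 : ℝ) : ℂ) := by
  have hsq : ∀ z : ℂ, ((‖z‖ ^ 2 : ℝ) : ℂ) = z * (starRingEnd ℂ) z := fun z => by
    rw [Complex.mul_conj, Complex.normSq_eq_norm_sq]
  induction N with
  | zero => simp [expSum]
  | succ N ih =>
    have hE : expSum (N + 1) y = expSum N y + wave N y := Finset.sum_range_succ _ _
    have hw : wave N y * wave (-N) y = 1 := by rw [← wave_add, add_neg_cancel, wave_zero]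
    rw [Finset.sum_range_succ, ih, dirichletKernel_eq, hsq, hsq, hE, map_add, conj_wave]
    linear_combination -hw

theorem integral_norm_expSum_sq (N : ℕ) :
    ∫ x in (-Real.pi)..Real.pi, ‖expSum N x‖ ^ 2 = 2 * Real.pi * N := by
  have h : ∫ x in (-Real.pi)..Real.pi, ((‖expSum N x‖ ^ 2 : ℝ) : ℂ) = 2 * Real.pi * N := by
    simp only [← sum_dirichletKernel]
    rw [intervalIntegral.integral_finsetSum fun m _ =>
      Continuous.intervalIntegrable (by fun_prop) _ _]
    simp only [integral_dirichletKernel]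
    simp
    ring
  rw [intervalIntegral.integral_ofReal] at h
  exact_mod_cast h

/-- The de la Vallée Poussin kernel. -/
def vpKernel (n : ℕ) (y : ℝ) : ℂ :=
  (1 / n : ℂ) * ∑ m ∈ Finset.range n, dirichletKernel (n + m) y

@[fun_prop]
theorem continuous_vpKernel (n : ℕ) : Continuous (vpKernel n) := by
  unfold vpKernel; fun_prop

theorem vpKernel_periodic (n : ℕ) : Function.Periodic (vpKernel n) (2 * Real.pi) := by
  intro x
  simp only [vpKernel, dirichletKernel, (wave_periodic _) x]

/-- The kernel is `1/n` times the difference of the nonnegative Fejér sums of lengths `2n` and `n`,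
whose integrals are `4πn` and `2πn`. -/
theorem l1Norm_vpKernel_le {n : ℕ} (hn : 1 ≤ n) : l1Norm (vpKernel n) ≤ 6 * Real.pi := by
  have hn0 : (0 : ℝ) < n := by exact_mod_cast hn
  have hI : ∀ N, IntervalIntegrable (fun x => ‖expSum N x‖ ^ 2) volume (-Real.pi) Real.pi :=
    fun N => Continuous.intervalIntegrable (by fun_prop) _ _
  have heq : ∀ y, ∑ m ∈ Finset.range n, dirichletKernel (n + m) y
      = ((‖expSum (n + n) y‖ ^ 2 : ℝ) : ℂ) - ((‖expSum n y‖ ^ 2 : ℝ) : ℂ) := by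
    intro y
    rw [← sum_dirichletKernel, ← sum_dirichletKernel, Finset.sum_range_add]
    ring
  have hle : l1Norm (vpKernel n) ≤ ∫ x in (-Real.pi)..Real.pi,
      1 / n * (‖expSum (n + n) x‖ ^ 2 + ‖expSum n x‖ ^ 2) := by
    refine l1Norm_mono_of_norm_le (Continuous.intervalIntegrable (by fun_prop) _ _)
      (((hI _).add (hI _)).const_mul _) fun x _ => ?_
    rw [vpKernel, heq, norm_mul]
    have h1 : ‖(1 / n : ℂ)‖ = 1 / n := by simp
    rw [h1]
    refine mul_le_mul_of_nonneg_left ((norm_sub_le _ _).trans (le_of_eq ?_)) (by positivity)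
    rw [Complex.norm_real, Complex.norm_real, Real.norm_of_nonneg (by positivity),
      Real.norm_of_nonneg (by positivity)]
  refine hle.trans (le_of_eq ?_)
  rw [intervalIntegral.integral_const_mul, intervalIntegral.integral_add (hI _) (hI _),
    integral_norm_expSum_sq, integral_norm_expSum_sq]
  push_cast
  field_simp
  ring

/-- Young's inequality for the convolution of an integrable function with a continuous periodic
kernel. -/
theorem l1Norm_convolution_le {K h : ℝ → ℂ} (hK : Continuous K)
    (hper : Function.Periodic K (2 * Real.pi))
    (hh : IntervalIntegrable h volume (-Real.pi) Real.pi) :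
    l1Norm (fun x => ∫ t in (-Real.pi)..Real.pi, K (x - t) * h t) ≤ l1Norm K * l1Norm h := by
  obtain ⟨C, hC⟩ : ∃ C, ∀ y, ‖K y‖ ≤ C := by
    have hb := hper.isBounded_of_continuous (by positivity) hK
    obtain ⟨C, hC⟩ := hb.exists_norm_le
    exact ⟨C, fun y => hC _ ⟨y, rfl⟩⟩
  set μ : Measure ℝ := volume.restrict (Set.Ioc (-Real.pi) Real.pi) with hμ
  have hh' : Integrable h μ := (intervalIntegrable_iff_integrableOn_Ioc_of_le neg_pi_le_pi).1 hh
  have hprod : Integrable (Function.uncurry fun x t => K (x - t) * h t) (μ.prod μ) := by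
    refine Integrable.bdd_mul (c := C) (hh'.comp_snd μ) ?_ (Eventually.of_forall fun p => hC _)
    exact Continuous.aestronglyMeasurable (by fun_prop)
  have hnorm : Integrable (Function.uncurry fun x t => ‖K (x - t)‖ * ‖h t‖) (μ.prod μ) := by
    refine hprod.norm.congr (Eventually.of_forall fun p => ?_)
    simp [Function.uncurry]
  have hinner : ∀ t, ∫ x, ‖K (x - t)‖ ∂μ = l1Norm K := by
    intro t
    rw [hμ, ← intervalIntegral.integral_of_le neg_pi_le_pi,
      intervalIntegral.integral_comp_sub_right fun x => ‖K x‖]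
    have hp : Function.Periodic (fun x => ‖K x‖) (2 * Real.pi) := fun x => by
      simp only [hper x]
    have := hp.intervalIntegral_add_eq (-Real.pi - t) (-Real.pi)
    rw [show -Real.pi - t + 2 * Real.pi = Real.pi - t by ring,
      show -Real.pi + 2 * Real.pi = Real.pi by ring] at this
    exact this
  unfold l1Norm
  simp only [intervalIntegral.integral_of_le neg_pi_le_pi]
  rw [← hμ]
  calc ∫ x, ‖∫ t, K (x - t) * h t ∂μ‖ ∂μ
      ≤ ∫ x, ∫ t, ‖K (x - t)‖ * ‖h t‖ ∂μ ∂μ := by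
        refine integral_mono hprod.integral_prod_left.norm hnorm.integral_prod_left fun x => ?_
        refine (norm_integral_le_integral_norm _).trans (le_of_eq ?_)
        simp only [norm_mul]
    _ = ∫ t, ∫ x, ‖K (x - t)‖ * ‖h t‖ ∂μ ∂μ := integral_integral_swap hnorm
    _ = ∫ t, l1Norm K * ‖h t‖ ∂μ := by
        refine integral_congr_ae (Eventually.of_forall fun t => ?_)
        simp only [integral_mul_const, hinner]
    _ = _ := by
        rw [integral_const_mul, l1Norm, intervalIntegral.integral_of_le neg_pi_le_pi]

/-! ### Convergence of the de la Vallée Poussin means in `L¹`. -/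

/-- The de la Vallée Poussin mean of the partial sums. -/
def vpMean (f : ℝ → ℂ) (n : ℕ) (x : ℝ) : ℂ :=
  (1 / n : ℂ) * ∑ m ∈ Finset.range n, partialSum f (n + m) x

@[fun_prop]
theorem continuous_vpMean (f : ℝ → ℂ) (n : ℕ) : Continuous (vpMean f n) := by
  unfold vpMean; fun_prop

theorem intervalIntegrable_comp_sub_mul {K f : ℝ → ℂ} (hK : Continuous K)
    (hf : IntervalIntegrable f volume (-Real.pi) Real.pi) (x : ℝ) :
    IntervalIntegrable (fun t => K (x - t) * f t) volume (-Real.pi) Real.pi :=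
  hf.continuousOn_mul (hK.comp (by fun_prop)).continuousOn

theorem partialSum_eq_convolution {f : ℝ → ℂ}
    (hf : IntervalIntegrable f volume (-Real.pi) Real.pi) (m : ℕ) (x : ℝ) :
    partialSum f m x = (1 / (2 * Real.pi) : ℂ) *
      ∫ t in (-Real.pi)..Real.pi, dirichletKernel m (x - t) * f t := by
  simp only [dirichletKernel, Finset.sum_mul]
  rw [intervalIntegral.integral_finsetSum fun k _ =>
    intervalIntegrable_comp_sub_mul (continuous_wave k) hf x, Finset.mul_sum, partialSum_eq]
  refine Finset.sum_congr rfl fun k _ => ?_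
  simp only [wave_sub_apply, mul_assoc]
  rw [intervalIntegral.integral_const_mul, coeff_eq_integral_wave]
  ring

theorem vpMean_eq_convolution {f : ℝ → ℂ}
    (hf : IntervalIntegrable f volume (-Real.pi) Real.pi) (n : ℕ) (x : ℝ) :
    vpMean f n x = (1 / (2 * Real.pi) : ℂ) *
      ∫ t in (-Real.pi)..Real.pi, vpKernel n (x - t) * f t := by
  simp only [vpKernel, mul_assoc, Finset.sum_mul]
  rw [intervalIntegral.integral_const_mul, intervalIntegral.integral_finsetSum fun m _ =>
    intervalIntegrable_comp_sub_mul (continuous_dirichletKernel _) hf x, vpMean]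
  simp only [partialSum_eq_convolution hf, ← Finset.mul_sum]
  ring

theorem l1Norm_vpMean_le {f : ℝ → ℂ}
    (hf : IntervalIntegrable f volume (-Real.pi) Real.pi) {n : ℕ} (hn : 1 ≤ n) :
    l1Norm (vpMean f n) ≤ 3 * l1Norm f := by
  have hpi := Real.pi_pos
  have heq : vpMean f n = fun x => (1 / (2 * Real.pi) : ℂ) *
      ∫ t in (-Real.pi)..Real.pi, vpKernel n (x - t) * f t :=
    funext (vpMean_eq_convolution hf n)
  have hc : ‖(1 / (2 * Real.pi) : ℂ)‖ = 1 / (2 * Real.pi) := by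
    simp [abs_of_pos hpi]
  rw [heq, l1Norm_const_mul, hc]
  have h1 := l1Norm_convolution_le (continuous_vpKernel n) (vpKernel_periodic n) hf
  have h2 := mul_le_mul_of_nonneg_right (l1Norm_vpKernel_le hn) (l1Norm_nonneg f)
  calc _ ≤ 1 / (2 * Real.pi) * (6 * Real.pi * l1Norm f) :=
        mul_le_mul_of_nonneg_left (h1.trans h2) (by positivity)
    _ = 3 * l1Norm f := by field_simp; ring

theorem coeff_sub {f g : ℝ → ℂ} (hf : IntervalIntegrable f volume (-Real.pi) Real.pi)
    (hg : IntervalIntegrable g volume (-Real.pi) Real.pi) (k : ℤ) :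
    coeff (fun x => f x - g x) k = coeff f k - coeff g k := by
  simp only [coeff_eq_integral_wave, mul_sub]
  rw [intervalIntegral.integral_sub (intervalIntegrable_wave_mul hf _)
    (intervalIntegrable_wave_mul hg _)]
  ring

theorem vpMean_sub {f g : ℝ → ℂ} (hf : IntervalIntegrable f volume (-Real.pi) Real.pi)
    (hg : IntervalIntegrable g volume (-Real.pi) Real.pi) (n : ℕ) (x : ℝ) :
    vpMean (fun x => f x - g x) n x = vpMean f n x - vpMean g n x := by
  simp only [vpMean, partialSum_eq, coeff_sub hf hg, sub_mul, Finset.sum_sub_distrib, mul_sub]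

theorem coeff_trigPoly (s : Finset ℤ) (a : ℤ → ℂ) (k : ℤ) :
    coeff (fun x => ∑ k ∈ s, a k * wave k x) k = if k ∈ s then a k else 0 := by
  have hpi : (Real.pi : ℂ) ≠ 0 := by exact_mod_cast Real.pi_ne_zero
  rw [coeff_eq_integral_wave, integral_wave_mul_trigPoly]
  split_ifs
  · field_simp
  · simp

theorem partialSum_trigPoly {s : Finset ℤ} {m : ℕ} (hs : s ⊆ Finset.Icc (-(m : ℤ)) m)
    (a : ℤ → ℂ) (x : ℝ) :
    partialSum (fun x => ∑ k ∈ s, a k * wave k x) m x = ∑ k ∈ s, a k * wave k x := by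
  rw [partialSum_eq]
  simp only [coeff_trigPoly, ite_mul, zero_mul]
  rw [← Finset.sum_filter]
  congr 1
  ext k
  simp only [Finset.mem_filter]
  exact ⟨fun h => h.2, fun h => ⟨hs h, h⟩⟩

theorem vpMean_trigPoly {s : Finset ℤ} {n : ℕ} (hn : 1 ≤ n) (hs : s ⊆ Finset.Icc (-(n : ℤ)) n)
    (a : ℤ → ℂ) (x : ℝ) :
    vpMean (fun x => ∑ k ∈ s, a k * wave k x) n x = ∑ k ∈ s, a k * wave k x := by
  have hn0 : (n : ℂ) ≠ 0 := by exact_mod_cast (by omega : n ≠ 0)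
  have h : ∀ m ∈ Finset.range n, partialSum (fun x => ∑ k ∈ s, a k * wave k x) (n + m) x
      = ∑ k ∈ s, a k * wave k x := fun m _ =>
    partialSum_trigPoly (hs.trans (Finset.Icc_subset_Icc (by push_cast; omega)
      (by push_cast; omega))) a x
  rw [vpMean, Finset.sum_congr rfl h, Finset.sum_const, Finset.card_range, nsmul_eq_mul]
  field_simp

theorem exists_trigPoly_l1Norm_sub_lt {f : ℝ → ℂ}
    (hf : IntervalIntegrable f volume (-Real.pi) Real.pi) {ε : ℝ} (hε : 0 < ε) :
    ∃ (s : Finset ℤ) (a : ℤ → ℂ), l1Norm (fun x => f x - ∑ k ∈ s, a k * wave k x) < ε := by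
  have hpi := Real.pi_pos
  have : Fact (0 < 2 * Real.pi) := ⟨by positivity⟩
  have hend : -Real.pi + 2 * Real.pi = Real.pi := by ring
  have hF : MemLp (AddCircle.liftIoc (2 * Real.pi) (-Real.pi) f) 1
      (AddCircle.haarAddCircle (T := 2 * Real.pi)) := by
    refine MemLp.haarAddCircle (MemLp.memLp_liftIoc ?_)
    rw [hend, memLp_one_iff_integrable]
    exact (intervalIntegrable_iff_integrableOn_Ioc_of_le neg_pi_le_pi).1 hf
  have hmem : hF.toLp ∈ closure (Submodule.span ℂ (Set.range
      (fourierLp (T := 2 * Real.pi) 1)) : Set (Lp ℂ 1 AddCircle.haarAddCircle)) := by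
    rw [← Submodule.topologicalClosure_coe,
      span_fourierLp_closure_eq_top (by norm_num : (1 : ENNReal) ≠ ⊤)]
    trivial
  -- Haar measure on the circle has total mass one, hence the factor `2π` against the norm on `[-π,
  -- π]`.
  obtain ⟨P, hP, hdist⟩ := Metric.mem_closure_iff.1 hmem (ε / (2 * Real.pi)) (by positivity)
  obtain ⟨a, rfl⟩ := Finsupp.mem_span_range_iff_exists_finsupp.1 hP
  refine ⟨a.support, a, ?_⟩
  have hsum : ((a.sum fun i c => c • fourierLp (T := 2 * Real.pi) 1 i :
      Lp ℂ 1 AddCircle.haarAddCircle) : AddCircle (2 * Real.pi) → ℂ)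
      =ᵐ[AddCircle.haarAddCircle] fun y => ∑ k ∈ a.support, a k * fourier k y := by
    have heq : (a.sum fun i c => c • fourierLp (T := 2 * Real.pi) 1 i)
        = ContinuousMap.toLp (E := ℂ) 1 AddCircle.haarAddCircle ℂ
          (∑ k ∈ a.support, a k • fourier k) := by
      simp [Finsupp.sum, map_sum, map_smul]
    rw [heq]
    refine (ContinuousMap.coeFn_toLp _ _).trans (Eventually.of_forall fun y => ?_)
    simp [ContinuousMap.sum_apply]
  rw [dist_eq_norm, L1.norm_eq_integral_norm] at hdist
  have hcongr : ∀ᵐ y ∂(AddCircle.haarAddCircle (T := 2 * Real.pi)),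
      ‖(hF.toLp - a.sum fun i c => c • fourierLp (T := 2 * Real.pi) 1 i :
        Lp ℂ 1 AddCircle.haarAddCircle) y‖
      = ‖AddCircle.liftIoc (2 * Real.pi) (-Real.pi) f y
          - ∑ k ∈ a.support, a k * fourier k y‖ := by
    filter_upwards [Lp.coeFn_sub hF.toLp (a.sum fun i c => c • fourierLp (T := 2 * Real.pi) 1 i),
      hsum, hF.coeFn_toLp] with y h1 h2 h3
    rw [h1, Pi.sub_apply, h2, h3]
  rw [integral_congr_ae hcongr, AddCircle.integral_haarAddCircle,
    ← AddCircle.intervalIntegral_preimage (2 * Real.pi) (-Real.pi), hend, smul_eq_mul,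
    inv_mul_eq_div, div_lt_div_iff_of_pos_right (by positivity)] at hdist
  refine lt_of_eq_of_lt ?_ hdist
  refine intervalIntegral.integral_congr_ae (Eventually.of_forall fun x hx => ?_)
  rw [Set.uIoc_of_le neg_pi_le_pi] at hx
  rw [AddCircle.liftIoc_coe_apply (by rwa [hend])]
  refine congrArg (fun z => ‖f x - z‖) (Finset.sum_congr rfl fun k _ => ?_)
  rw [fourier_coe_apply, wave]
  congr 2
  have : (Real.pi : ℂ) ≠ 0 := by exact_mod_cast Real.pi_ne_zero
  push_cast
  field_simp

theorem tendsto_l1Norm_sub_vpMean {f : ℝ → ℂ}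
    (hf : IntervalIntegrable f volume (-Real.pi) Real.pi) :
    Tendsto (fun n : ℕ => l1Norm (fun x => f x - vpMean f n x)) atTop (𝓝 0) := by
  rw [Metric.tendsto_atTop]
  intro ε hε
  obtain ⟨s, a, hsa⟩ := exists_trigPoly_l1Norm_sub_lt hf (by positivity : 0 < ε / 4)
  obtain ⟨n₀, hn₀⟩ : ∃ n₀ : ℕ, ∀ k ∈ s, k.natAbs ≤ n₀ :=
    ⟨s.sup Int.natAbs, fun k hk => Finset.le_sup (f := Int.natAbs) hk⟩
  refine ⟨max 1 n₀, fun n hn => ?_⟩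
  have hn1 : 1 ≤ n := (le_max_left _ _).trans hn
  have hs : s ⊆ Finset.Icc (-(n : ℤ)) n := by
    intro k hk
    have := (hn₀ k hk).trans ((le_max_right _ _).trans hn)
    rw [Finset.mem_Icc]
    omega
  rw [Real.dist_eq, sub_zero, abs_of_nonneg (l1Norm_nonneg _)]
  set P : ℝ → ℂ := fun x => ∑ k ∈ s, a k * wave k x with hP
  have hPI : IntervalIntegrable P volume (-Real.pi) Real.pi :=
    Continuous.intervalIntegrable (by fun_prop) _ _
  -- The mean fixes `P`, so the error is `(f - P) - V_n(f - P)`, of norm at most `(1 + 3)‖f - P‖`;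
  -- this is why `P` was chosen within `ε/4`.
  have heq : (fun x => f x - vpMean f n x)
      = fun x => (f x - P x) + -vpMean (fun x => f x - P x) n x := by
    funext x
    rw [vpMean_sub hf hPI, hP, vpMean_trigPoly hn1 hs a x]
    ring
  have h1 := l1Norm_vpMean_le (hf.sub hPI) hn1
  have h2 := l1Norm_add_le (hf.sub hPI) (h := fun x => -vpMean (fun x => f x - P x) n x)
    (Continuous.intervalIntegrable (by fun_prop) _ _)
  rw [l1Norm_neg] at h2
  rw [heq]
  exact (h2.trans (add_le_add_right h1 _)).trans_lt (by linarith)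

/-! ### Small blocks and sufficiency. -/

theorem log_add_one_le_two_mul_log {n : ℕ} (hn : 2 ≤ n) :
    Real.log (n + 1) ≤ 2 * Real.log n := by
  have h2 : (2 : ℝ) ≤ n := by exact_mod_cast hn
  have : 2 * Real.log n = Real.log ((n : ℝ) ^ 2) := by rw [Real.log_pow]; norm_num
  rw [this]
  apply Real.log_le_log (by positivity)
  nlinarith

theorem IsGBV.eventually_l1Norm_block_le {c : ℕ → ℂ} (hc : IsGBV c)
    (h : Tendsto (fun n : ℕ => ‖c n‖ * Real.log n) atTop (𝓝 0)) {ε : ℝ} (hε : 0 < ε) :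
    ∀ᶠ n : ℕ in atTop, ∀ N ≤ n,
      l1Norm (fun x => ∑ l ∈ Finset.range N, c (n + 1 + l) * wave (n + 1 + l) x) ≤ ε := by
  have hpi := Real.pi_pos
  obtain ⟨-, N₀, hN, M, hM, hvar⟩ := hc
  -- The block bound contributes `4π`, replacing `log (T+2)` by `2 log n` doubles it, and the last
  -- coefficient plus the variation gives `1 + M`.
  set δ : ℝ := ε / (8 * Real.pi * (1 + M)) with hδ
  have hδ0 : 0 < δ := by positivity
  obtain ⟨n₀, hn₀⟩ := eventually_atTop.1 (h.eventually (gt_mem_nhds hδ0))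
  filter_upwards [eventually_ge_atTop n₀, eventually_ge_atTop 2] with n hn hn2 N hNn
  have hn2' : (2 : ℝ) ≤ n := by exact_mod_cast hn2
  have hlog : 0 < Real.log n := Real.log_pos (by linarith)
  have hck : ∀ k, n ≤ k → ‖c k‖ ≤ δ / Real.log n := by
    intro k hk
    rw [le_div_iff₀ hlog]
    refine le_trans (mul_le_mul_of_nonneg_left ?_ (norm_nonneg _)) (hn₀ k (hn.trans hk)).le
    exact Real.log_le_log (by linarith) (by exact_mod_cast hk)
  rcases N with _ | T
  · simpa [l1Norm] using hε.le
  have hblock := l1Norm_block_le (fun l => c (n + 1 + l)) (n + 1) T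
  have hsum : ∑ l ∈ Finset.range T, ‖c (n + 1 + l) - c (n + 1 + (l + 1))‖
      ≤ M * (δ / Real.log n) := by
    have hsup : (((Finset.Ico n (n + N₀)).sup (fun n => ‖c n‖₊) : NNReal) : ℝ)
        ≤ δ / Real.log n := by
      have : (Finset.Ico n (n + N₀)).sup (fun n => ‖c n‖₊)
          ≤ (⟨δ / Real.log n, by positivity⟩ : NNReal) :=
        Finset.sup_le fun k hk => hck k (Finset.mem_Ico.1 hk).1
      exact this
    -- The condition is applied at `n`, although the block starts at `n+1`; its differences have
    -- indices in `[n+1, n+T]`, inside `[n, 2n]`.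
    refine le_trans ?_ ((hvar n (by omega)).trans (mul_le_mul_of_nonneg_left hsup hM.le))
    have := Finset.sum_Ico_eq_sum_range (fun k => ‖c k - c (k + 1)‖) (n + 1) (n + 1 + T)
    rw [Nat.add_sub_cancel_left] at this
    simp only [← add_assoc] at this ⊢
    rw [← this]
    refine Finset.sum_le_sum_of_subset_of_nonneg ?_ fun _ _ _ => norm_nonneg _
    intro k hk
    rw [Finset.mem_Ico] at hk
    rw [Finset.mem_Icc]
    omega
  have hlogT : Real.log (T + 2) ≤ 2 * Real.log n := by
    refine le_trans (Real.log_le_log (by positivity) ?_) (log_add_one_le_two_mul_log hn2)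
    have : ((T + 1 : ℕ) : ℝ) ≤ n := by exact_mod_cast hNn
    push_cast at this
    linarith
  refine hblock.trans ?_
  calc _ ≤ (δ / Real.log n + M * (δ / Real.log n)) * (4 * Real.pi * (2 * Real.log n)) := by
        have := hck (n + 1 + T) (by omega)
        have hT0 : 0 ≤ Real.log ((T : ℝ) + 2) :=
          Real.log_nonneg (by linarith [Nat.cast_nonneg (α := ℝ) T])
        gcongr
    _ = ε := by
        rw [hδ]
        field_simp
        ring

theorem partialSum_add (f : ℝ → ℂ) (n N : ℕ) (x : ℝ) :
    partialSum f (n + N) x - partialSum f n x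
      = ∑ l ∈ Finset.range N, coeff f ((n + 1 + l : ℕ) : ℤ) * wave (n + 1 + l) x
        + ∑ l ∈ Finset.range N, coeff f (-((n + 1 + l : ℕ) : ℤ)) * wave (n + 1 + l) (-x) := by
  rw [partialSum_eq, partialSum_eq, sum_Icc_neg_add, add_sub_cancel_left, Finset.sum_add_distrib]
  simp only [wave_neg_apply]
  push_cast
  rfl

theorem tendsto_l1Norm_of_tendsto_coeff_log {f : ℝ → ℂ}
    (hf : IntervalIntegrable f volume (-Real.pi) Real.pi)
    (hpos : IsGBV (fun n : ℕ => coeff f (n : ℤ)))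
    (hneg : IsGBV (fun n : ℕ => coeff f (-(n : ℤ))))
    (h1 : Tendsto (fun n : ℕ => ‖coeff f (n : ℤ)‖ * Real.log n) atTop (𝓝 0))
    (h2 : Tendsto (fun n : ℕ => ‖coeff f (-(n : ℤ))‖ * Real.log n) atTop (𝓝 0)) :
    Tendsto (fun n : ℕ => l1Norm (fun x => f x - partialSum f n x)) atTop (𝓝 0) := by
  rw [Metric.tendsto_nhds]
  intro ε hε
  have hε4 : 0 < ε / 4 := by positivity
  filter_upwards [hpos.eventually_l1Norm_block_le h1 hε4, hneg.eventually_l1Norm_block_le h2 hε4,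
    (tendsto_l1Norm_sub_vpMean hf).eventually (gt_mem_nhds hε4), eventually_ge_atTop 1]
    with n hp hm hv hn
  rw [Real.dist_eq, sub_zero, abs_of_nonneg (l1Norm_nonneg _)]
  have hn0 : (n : ℂ) ≠ 0 := by exact_mod_cast (by omega : n ≠ 0)
  have hdiff : ∀ m ∈ Finset.range n,
      l1Norm (fun x => partialSum f (n + m) x - partialSum f n x) ≤ ε / 2 := by
    intro m hm'
    have hmn := (Finset.mem_range.1 hm').le
    simp only [partialSum_add]
    refine (l1Norm_add_le (Continuous.intervalIntegrable (by fun_prop) _ _)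
      (Continuous.intervalIntegrable (by fun_prop) _ _)).trans ?_
    rw [l1Norm_comp_neg fun x => ∑ l ∈ Finset.range m,
      coeff f (-((n + 1 + l : ℕ) : ℤ)) * wave (n + 1 + l) x]
    linarith [hp m hmn, hm m hmn]
  have hmean : l1Norm (fun x => vpMean f n x - partialSum f n x) ≤ ε / 2 := by
    have heq : (fun x => vpMean f n x - partialSum f n x) = fun x => (1 / n : ℂ) *
        ∑ m ∈ Finset.range n, (partialSum f (n + m) x - partialSum f n x) := by
      funext x
      rw [Finset.sum_sub_distrib, Finset.sum_const, Finset.card_range, nsmul_eq_mul, vpMean]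
      field_simp
    rw [heq, l1Norm_const_mul]
    have hs := (l1Norm_sum_le (Finset.range n)
      (g := fun m x => partialSum f (n + m) x - partialSum f n x)
      fun m _ => Continuous.intervalIntegrable (by fun_prop) _ _).trans
      (Finset.sum_le_sum hdiff)
    rw [Finset.sum_const, Finset.card_range, nsmul_eq_mul] at hs
    have hn0' : (0 : ℝ) < n := by exact_mod_cast hn
    have hnorm : ‖(1 / n : ℂ)‖ = 1 / n := by simp
    rw [hnorm, one_div_mul_eq_div, div_le_iff₀ hn0']
    linarith
  have htri := l1Norm_add_le (g := fun x => f x - vpMean f n x)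
    (h := fun x => vpMean f n x - partialSum f n x)
    (hf.sub (Continuous.intervalIntegrable (by fun_prop) _ _))
    (Continuous.intervalIntegrable (by fun_prop) _ _)
  simp only [sub_add_sub_cancel] at htri
  linarith

/-! ### The two-sided limit and the conclusion. -/

theorem tendsto_int_iff_tendsto_nat {α : Type*} {g : ℤ → α} {l : Filter α} :
    Tendsto g (atBot ⊔ atTop) l ↔
      Tendsto (fun n : ℕ => g n) atTop l ∧ Tendsto (fun n : ℕ => g (-(n : ℤ))) atTop l := by
  have hcast : map (Nat.cast : ℕ → ℤ) atTop = atTop := by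
    ext s
    simp only [mem_map, mem_atTop_sets, Set.mem_preimage]
    constructor
    · rintro ⟨a, ha⟩
      refine ⟨a, fun b hb => ?_⟩
      lift b to ℕ using by omega
      exact ha b (by exact_mod_cast hb)
    · rintro ⟨a, ha⟩
      exact ⟨a.toNat, fun b hb => ha b (by omega)⟩
  rw [tendsto_sup, and_comm, ← map_neg_atTop, ← hcast, tendsto_map'_iff, tendsto_map'_iff,
    tendsto_map'_iff]
  rfl

end GBVFourier

end

theorem corollary1 (f : ℝ → ℂ) (hper : Function.Periodic f (2 * Real.pi))
    (hint : IntervalIntegrable f volume (-Real.pi) Real.pi)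
    (hpos : GBVFourier.IsGBV (fun n : ℕ => GBVFourier.coeff f (n : ℤ)))
    (hneg : GBVFourier.IsGBV (fun n : ℕ => GBVFourier.coeff f (-(n : ℤ)))) :
    Tendsto (fun n : ℕ => GBVFourier.l1Norm (fun x => f x - GBVFourier.partialSum f n x))
        atTop (𝓝 0) ↔
      Tendsto (fun n : ℤ => GBVFourier.coeff f n * (Real.log |(n : ℝ)| : ℂ))
        (atBot ⊔ atTop) (𝓝 0) := by
  -- The case `n = 0` is included because `Real.log 0 = 0`.
  have hnorm : ∀ (z : ℂ) (n : ℕ), ‖z * (Real.log n : ℂ)‖ = ‖z‖ * Real.log n := fun z n => by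
    rw [norm_mul, Complex.norm_real, Real.norm_of_nonneg (Real.log_natCast_nonneg n)]
  rw [GBVFourier.tendsto_int_iff_tendsto_nat,
    tendsto_zero_iff_norm_tendsto_zero (f := fun n : ℕ => GBVFourier.coeff f (n : ℤ) * _),
    tendsto_zero_iff_norm_tendsto_zero (f := fun n : ℕ => GBVFourier.coeff f (-(n : ℤ)) * _)]
  simp only [Int.cast_neg, Int.cast_natCast, abs_neg, Nat.abs_cast, hnorm]
  exact ⟨fun h => ⟨GBVFourier.tendsto_coeff_log_of_tendsto_l1Norm hint hpos h,
      GBVFourier.tendsto_coeff_neg_log_of_tendsto_l1Norm hint hneg h⟩,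
    fun h => GBVFourier.tendsto_l1Norm_of_tendsto_coeff_log hint hpos hneg h.1 h.2⟩
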